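/- **Conventions (fractals).** For a finite set $G\subset\mathbb Z^2$ let $l_G,r_G$ be the least and greatest first coordinates and $b_G,t_G$ the least and greatest second coordinates of points of $G$, and let $w_G=r_G-l_G+1$, $h_G=t_G-b_G+1$. The four sides of its bounding box are $L_G=\{l_G\}\times[b_G,t_G]$, $R_G=\{r_G\}\times[b_G,t_G]$, $B_G=[l_G,r_G]\times\{b_G\}$, $T_G=[l_G,r_G]\times\{t_G\}$ (integer points). The full grid graph of $V\subseteq\mathbb Z^2$ joins two points of $V$ iff they are at distance $1$. A set $\boldsymbol X\subset\mathbb N^2$ is a *discrete self-similar fractal* (dssf) with generator $G$ if $G\subset\mathbb N^2$ is finite, $\{(0,0)\}\subsetneq G\subsetneq\{0,\dots,w_G-1\}\times\{0,\dots,h_G-1\}$, $w_G>1$, $h_G>1$, $G$ meets every row and column of its bounding box, the full grid graph of $G$ is connected, and $\boldsymbol X=\bigcup_{i\ge1}X_i$, where $X_1=G$ and $X_{i+1}=\{(a_1+w_G^{\,i}b_1,\;a_2+h_G^{\,i}b_2): a\in X_i,\ b\in G\}$. It is *$n$-sided* if it has a generator $G$ that contains at least $n$ distinct sets among $L_G,R_G,T_G,B_G$.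 A *tree fractal* is a dssf whose full grid graph is a tree. **Conventions (2HAM).** A glue is a pair of a label (a string over an alphabet) and a strength in $\mathbb N$. A tile type is a unit square with a glue on each of its four sides, together with a label. A 2HAM tile assembly system (TAS) $\mathcal T=(T,\tau)$ consists of a finite nonempty set $T$ of tile types and a temperature $\tau\in\mathbb N$, $\tau\ge1$. A supertile is, up to translation, a partial map from $\mathbb Z^2$ to $T$. In its binding graph two adjacent tiles are joined by an edge of weight $s>0$ if the glues on their abutting sides are equal (label and strength) and have strength $s$. It is $\tau$-stable if every cut of the binding graph has total weight at least $\tau$. Two $\tau$-stable supertiles are $\tau$-combinable into a third if they can be placed without overlap so that their union is that third supertile and is $\tau$-stable. The finite *producible* supertiles are the single tiles with types in $T$ and all supertiles obtained from these by finitely many $\tau$-combinations. $\mathcal T$ *finitely self-assembles* an infinite shape $X\subseteq\mathbb Z^2$ if every finite producible supertile $\alpha$ has, up to translation, the shape of a subset of $X$, and there is an infinite assembly sequence $\alpha=\alpha_0,\alpha_1,\alpha_2,\dots$, each $\alpha_{i+1}$ being a $\tau$-combination of $\alpha_i$ with a finite producible supertile, whose result (the union of the $\alpha_i$, each placed as a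 part of the next) has shape $X$ up to translation. **Theorem 2.** There exists a $3$-sided fractal $\boldsymbol X$ that is not a tree fractal and that no 2HAM TAS $\mathcal T=(T,\tau)$, at any temperature $\tau$, finitely self-assembles. In fact, the dssf $\boldsymbol X$ with the 13-point generator $$G=\{(0,4),(1,4),(2,4),(3,4),(0,3),(2,3),(0,2),(2,2),(0,1),(0,0),(1,0),(2,0),(3,0)\}$$ has all these properties. -/

import Mathlib

/-! ## The two-handed tile assembly model -/

namespace TwoHAM

/-- The four sides of a unit square. -/
inductive Side
  | north
  | south
  | east
  | west
  deriving DecidableEq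

instance : Fintype Side where
  elems := {.north, .south, .east, .west}
  complete := fun d => by cases d <;> decide

/-- The unit vector of `ℤ²` that corresponds to a side. -/
def Side.vec : Side → ℤ × ℤ
  | .north => (0, 1)
  | .south => (0, -1)
  | .east => (1, 0)
  | .west => (-1, 0)

/-- The side that abuts a given side of a tile on the neighbouring tile. -/
def Side.opp : Side → Side
  | .north => .south
  | .south => .north
  | .east => .west
  | .west => .east

/-- A glue: a label (a string over the alphabet `Λ`) and a non-negative integer strength. -/
structure Glue (Λ : Type*) where
  label : List Λ
  strength : ℕ

/-- A tile type: a glue on each of the four sides, and a label. -/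
structure TileType (Λ : Type*) where
  glue : Side → Glue Λ
  label : List Λ

/-- A positioned supertile, finite or infinite: a set of positioned tiles with distinct locations,
i.e. a partial function from `ℤ²` to tile types. A supertile is the class of all translates of a
positioned supertile; every notion below is invariant under translation, and a supertile
is represented by any of its positioned members. -/
abbrev Supertile (Λ : Type*) := ℤ × ℤ → Option (TileType Λ)

namespace Supertile

variable {Λ : Type*}

/-- The set of tile locations. -/
def dom (A : Supertile Λ) : Set (ℤ × ℤ) := {p | A p ≠ none}

/-- The positioned supertile that consists of the single tile `t` at location `p`. -/
def single (t : TileType Λ) (p : ℤ × ℤ) : Supertile Λ := fun q => if q = p then some t else none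

/-- The union of two positioned supertiles (used for disjoint ones only). -/
def union (A B : Supertile Λ) : Supertile Λ := fun p => (A p).or (B p)

open Classical in
/-- The weight of the pair of locations `p`, `q` in the binding graph of `A`: the strength with
which the tiles at `p` and `q` interact. It is zero unless `A` has tiles at both locations, the
locations are adjacent, and the glues on the abutting sides are equal (labels and strengths).
At most one side `d` contributes to the sum. -/
noncomputable def bond (A : Supertile Λ) (p q : ℤ × ℤ) : ℕ :=
  match A p, A q with
  | some t, some u =>
      ∑ d : Side, if q = p + d.vec ∧ t.glue d = u.glue d.opp then (t.glue d).strength else 0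
  | _, _ => 0

/-- `A` is `τ`-stable: for every cut of the binding graph, that is, every partition of the
locations into two nonempty sets `S` and `A.dom \ S`, the weights of the edges between `S` and
`A.dom \ S` have sum at least `τ`. As `A` may be infinite, this is said as: some finite set of
such edges has total weight at least `τ`. -/
def Stable (τ : ℕ) (A : Supertile Λ) : Prop :=
  ∀ S : Set (ℤ × ℤ), S ⊆ A.dom → S.Nonempty → (A.dom \ S).Nonempty →
    ∃ E : Finset ((ℤ × ℤ) × (ℤ × ℤ)),
      (∀ e ∈ E, e.1 ∈ S ∧ e.2 ∈ A.dom \ S) ∧ τ ≤ ∑ e ∈ E, A.bond e.1 e.2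

/-- `A` and `B` are `τ`-combinable into `C`: all three are `τ`-stable, `A` and `B` do not overlap,
and `C` is their union. -/
structure Combinable (τ : ℕ) (A B C : Supertile Λ) : Prop where
  stable_left : A.Stable τ
  stable_right : B.Stable τ
  disjoint : Disjoint A.dom B.dom
  eq_union : C = A.union B
  stable : C.Stable τ

/-- The supertile of `A` has shape `X`: the locations of some translate of `A` form the set `X`. -/
def HasShape (A : Supertile Λ) (X : Set (ℤ × ℤ)) : Prop :=
  ∃ v : ℤ × ℤ, (fun p => p + v) '' A.dom = X

end Supertile

/-- A 2HAM tile assembly system: a finite, nonempty set of tile types and a positive integer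
temperature. -/
structure TileSystem (Λ : Type*) where
  tiles : Finset (TileType Λ)
  tiles_nonempty : tiles.Nonempty
  temperature : ℕ
  temperature_pos : 0 < temperature

namespace TileSystem

variable {Λ : Type*}

/-- The finite producible supertiles: the supertiles that occur in the states that are reached
from the initial state, which has infinitely many copies of each single tile, by finitely many
transitions, each of which adds a supertile into which two supertiles that are already present
are combinable. -/
inductive Producible (𝒯 : TileSystem Λ) : Supertile Λ → Prop
  | tile (t : TileType Λ) (ht : t ∈ 𝒯.tiles) (p : ℤ × ℤ) : Producible 𝒯 (Supertile.single t p)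
  | combine (A B C : Supertile Λ) (hA : Producible 𝒯 A) (hB : Producible 𝒯 B)
      (hC : Supertile.Combinable 𝒯.temperature A B C) : Producible 𝒯 C

/-- An infinite assembly sequence: each supertile arises from the preceding one by combination with
a producible supertile. The positions are chosen so that each member contains the preceding one. -/
def IsAssemblySequence (𝒯 : TileSystem Λ) (A : ℕ → Supertile Λ) : Prop :=
  ∀ i, ∃ B, 𝒯.Producible B ∧ Supertile.Combinable 𝒯.temperature (A i) B (A (i + 1))

/-- `R` is the result of the assembly sequence `A`: the union of its members. -/
def IsResult (A : ℕ → Supertile Λ) (R : Supertile Λ) : Prop :=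
  ∀ p t, R p = some t ↔ ∃ i, A i p = some t

/-- `𝒯` finitely self-assembles the shape `X`: every finite producible supertile has the shape of
a subset of `X` and is the first member of an infinite assembly sequence whose result has
shape `X`. -/
def FinitelySelfAssembles (𝒯 : TileSystem Λ) (X : Set (ℤ × ℤ)) : Prop :=
  ∀ α : Supertile Λ, 𝒯.Producible α →
    (∃ Y ⊆ X, α.HasShape Y) ∧
    ∃ (A : ℕ → Supertile Λ) (R : Supertile Λ),
      A 0 = α ∧ 𝒯.IsAssemblySequence A ∧ IsResult A R ∧ R.HasShape X

end TileSystem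

end TwoHAM

/-! ## Discrete self-similar fractals -/

namespace Fractal

/-- The full grid graph of `V ⊆ ℤ²`: two points are adjacent iff they are at distance `1`. -/
def gridGraph (V : Set (ℤ × ℤ)) : SimpleGraph V where
  Adj p q := |p.1.1 - q.1.1| + |p.1.2 - q.1.2| = 1
  symm := ⟨fun p q h => by rw [abs_sub_comm q.1.1, abs_sub_comm q.1.2]; exact h⟩
  loopless := ⟨fun p h => by simp at h⟩

noncomputable section

variable (G : Finset (ℤ × ℤ))

/-- The least first coordinate of a point of `G`. -/
def left : ℤ := sInf (Prod.fst '' (G : Set (ℤ × ℤ)))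

/-- The greatest first coordinate of a point of `G`. -/
def right : ℤ := sSup (Prod.fst '' (G : Set (ℤ × ℤ)))

/-- The least second coordinate of a point of `G`. -/
def bottom : ℤ := sInf (Prod.snd '' (G : Set (ℤ × ℤ)))

/-- The greatest second coordinate of a point of `G`. -/
def top : ℤ := sSup (Prod.snd '' (G : Set (ℤ × ℤ)))

/-- The width of `G`. -/
def width : ℤ := right G - left G + 1

/-- The height of `G`. -/
def height : ℤ := top G - bottom G + 1

/-- The left side of the bounding box of `G`. -/
def leftSide : Finset (ℤ × ℤ) := {left G} ×ˢ Finset.Icc (bottom G) (top G)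

/-- The right side of the bounding box of `G`. -/
def rightSide : Finset (ℤ × ℤ) := {right G} ×ˢ Finset.Icc (bottom G) (top G)

/-- The top side of the bounding box of `G`. -/
def topSide : Finset (ℤ × ℤ) := Finset.Icc (left G) (right G) ×ˢ {top G}

/-- The bottom side of the bounding box of `G`. -/
def bottomSide : Finset (ℤ × ℤ) := Finset.Icc (left G) (right G) ×ˢ {bottom G}

/-- The set `A + (x, y) B` of the points `(a₁ + x b₁, a₂ + y b₂)` with `a ∈ A` and `b ∈ B`. -/
def addScaled (A : Set (ℤ × ℤ)) (x y : ℤ) (B : Set (ℤ × ℤ)) : Set (ℤ × ℤ) :=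
  {p | ∃ a ∈ A, ∃ b ∈ B, p = (a.1 + x * b.1, a.2 + y * b.2)}

/-- The stages of the fractal with generator `G`: `stage G i` is the stage of number `i + 1`. -/
def stage : ℕ → Set (ℤ × ℤ)
  | 0 => G
  | i + 1 => addScaled (stage i) (width G ^ (i + 1)) (height G ^ (i + 1)) G

/-- `G` is the generator of a discrete self-similar fractal. -/
structure IsGenerator : Prop where
  origin : {((0 : ℤ), (0 : ℤ))} ⊂ G
  in_box : ∃ g : ℕ, G ⊆ Finset.Ico 0 (g : ℤ) ×ˢ Finset.Ico 0 (g : ℤ)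
  row : ∀ y ∈ Finset.Icc (bottom G) (top G), ∃ x, (x, y) ∈ G
  column : ∀ x ∈ Finset.Icc (left G) (right G), ∃ y, (x, y) ∈ G
  connected : (gridGraph (G : Set (ℤ × ℤ))).Connected
  one_lt_width : 1 < width G
  one_lt_height : 1 < height G
  proper : G ⊂ Finset.Ico 0 (width G) ×ˢ Finset.Ico 0 (height G)

/-- `X` is a discrete self-similar fractal with generator `G`: the union of the stages. -/
def HasGenerator (X : Set (ℤ × ℤ)) : Prop := IsGenerator G ∧ X = ⋃ i, stage G i

end

/-- `X` is a discrete self-similar fractal. -/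
def IsDSSF (X : Set (ℤ × ℤ)) : Prop := ∃ G, HasGenerator G X

/-- `X` is an `n`-sided fractal: it is a discrete self-similar fractal with a generator that
contains at least `n` distinct sides of its bounding box. -/
def IsSided (n : ℕ) (X : Set (ℤ × ℤ)) : Prop :=
  ∃ G : Finset (ℤ × ℤ), HasGenerator G X ∧
    n ≤ (({leftSide G, rightSide G, topSide G, bottomSide G} :
      Finset (Finset (ℤ × ℤ))).filter (fun S => S ∩ G = S)).card

/-- `X` is a tree fractal: a discrete self-similar fractal whose full grid graph is a tree. -/
def IsTreeFractal (X : Set (ℤ × ℤ)) : Prop := IsDSSF X ∧ (gridGraph X).IsTree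

end Fractal

/-! ### Bonds, stability and cutting of supertiles -/

namespace TwoHAM

/-! At every scale, the blocks with digits (2,2) and (2,3) form a tooth that is joined to the rest
only from above. In a block of size 4^k by 5^k, the row whose base-five digits are all 1 can meet
the fractal only in the leftmost column, so cutting a tooth along that row severs a single edge
(`hangingPart_edge`). A stable supertile binds along such an edge with strength at least `τ`
(`Stable.le_bond`), and both pieces of a producible supertile cut there are producible
(`Producible.restrict`).

For each `k`, take a producible supertile inside the fractal that covers a block of level `k + 2`,
and look at the tile just above the cut of a tooth of level `k`. As there are finitely many tile
types, two levels with `k + 2 ≤ l` carry the same tile there. Hence the lower end of the large tooth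
binds under the stump of the small one, provided that there is room. To make room, only a segment of
the surrounding tooth of level `k + 1` is kept (`middlePart`): it has a long left column, the spine,
and nothing below the stump on the right (`lt_of_mem_middlePart`).

The resulting producible supertile contains two long columns at distance 2 * 4^k. Each crosses rows
whose digit of index `k` is 1, and in such rows the column digit must be 0; but the two column
digits differ by 2 modulo 4 (`not_two_columns`). So no translate of the supertile fits into the
fractal. -/

theorem Side.opp_opp (d : Side) : d.opp.opp = d := by cases d <;> rfl

theorem Side.vec_opp (d : Side) : d.opp.vec = -d.vec := by cases d <;> simp [Side.opp, Side.vec]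

namespace Supertile

variable {Λ : Type*}

theorem mem_dom {A : Supertile Λ} {p : ℤ × ℤ} : p ∈ A.dom ↔ ∃ t, A p = some t := by
  simp [dom, Option.ne_none_iff_exists']

theorem dom_union (A B : Supertile Λ) : (A.union B).dom = A.dom ∪ B.dom := by
  ext p
  simp only [dom, union, Set.mem_ofPred_eq, Set.mem_union]
  cases A p <;> simp

theorem dom_single (t : TileType Λ) (p : ℤ × ℤ) : (single t p).dom = {p} := by
  ext q
  simp [dom, single]

theorem union_apply_left {A B : Supertile Λ} {p : ℤ × ℤ} (h : p ∈ A.dom) :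
    A.union B p = A p := by
  obtain ⟨t, ht⟩ := mem_dom.1 h
  simp [union, ht]

theorem union_apply_right {A B : Supertile Λ} (hd : Disjoint A.dom B.dom) {p : ℤ × ℤ}
    (h : p ∈ B.dom) : A.union B p = B p := by
  have : A p = none := by
    by_contra hA
    exact Set.disjoint_left.1 hd hA h
  simp [union, this]

/-! ### Bonds -/

theorem bond_of_eq {A : Supertile Λ} {p q : ℤ × ℤ} {t u : TileType Λ} (hp : A p = some t)
    (hq : A q = some u) : A.bond p q = (open Classical in
      ∑ d : Side, if q = p + d.vec ∧ t.glue d = u.glue d.opp then (t.glue d).strength else 0) := by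
  unfold bond
  rw [hp, hq]

theorem bond_ne_zero {A : Supertile Λ} {p q : ℤ × ℤ} (h : A.bond p q ≠ 0) :
    p ∈ A.dom ∧ q ∈ A.dom ∧ ∃ d : Side, q = p + d.vec := by
  rcases hp : A p with _ | t
  · simp [bond, hp] at h
  rcases hq : A q with _ | u
  · simp [bond, hp, hq] at h
  refine ⟨by simp [dom, hp], by simp [dom, hq], ?_⟩
  rw [bond_of_eq hp hq] at h
  obtain ⟨d, -, hd⟩ := Finset.exists_ne_zero_of_sum_ne_zero h
  exact ⟨d, by_contra fun hn => hd (by simp [hn])⟩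

/-- A bond depends only on the two tiles and their relative position. This lets bonds be transported
between unions, restrictions and translates. -/
theorem bond_congr {A B : Supertile Λ} {p q p' q' : ℤ × ℤ} (hp : A p = B p') (hq : A q = B q')
    (h : q - p = q' - p') : A.bond p q = B.bond p' q' := by
  have key : ∀ d : Side, q = p + d.vec ↔ q' = p' + d.vec := fun d => by
    rw [← sub_eq_iff_eq_add', ← sub_eq_iff_eq_add', h]
  rcases hp' : B p' with _ | t
  · simp [bond, hp, hp']
  rcases hq' : B q' with _ | u
  · simp [bond, hq, hq']
  rw [bond_of_eq (hp.trans hp') (hq.trans hq'), bond_of_eq hp' hq']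
  classical exact Finset.sum_congr rfl fun d _ => if_congr (and_congr_left' (key d)) rfl rfl

theorem bond_comm (A : Supertile Λ) (p q : ℤ × ℤ) : A.bond p q = A.bond q p := by
  rcases hp : A p with _ | t <;> rcases hq : A q with _ | u
  · simp [bond, hp, hq]
  · simp [bond, hp, hq]
  · simp [bond, hp, hq]
  rw [bond_of_eq hp hq, bond_of_eq hq hp]
  refine Finset.sum_nbij' Side.opp Side.opp (by simp) (by simp) (fun d _ => d.opp_opp)
    (fun d _ => d.opp_opp) fun d _ => ?_
  rw [Side.opp_opp, Side.vec_opp]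
  by_cases hc : q = p + d.vec ∧ t.glue d = u.glue d.opp
  · rw [if_pos hc, if_pos ⟨by rw [hc.1]; abel, hc.2.symm⟩, hc.2]
  · rw [if_neg hc, if_neg]
    rintro ⟨h1, h2⟩
    exact hc ⟨by rw [h1]; abel, h2.symm⟩

theorem stable_single (τ : ℕ) (t : TileType Λ) (p : ℤ × ℤ) : (single t p).Stable τ := by
  intro S hS ⟨x, hx⟩ ⟨y, hy, hyS⟩
  rw [dom_single] at hS hy
  exact absurd (by rw [hy, ← hS hx]; exact hx) hyS

/-- Two stable supertiles that are joined by a sufficiently strong bond form a stable one. -/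
theorem Stable.union {τ : ℕ} {A B : Supertile Λ} (hA : A.Stable τ) (hB : B.Stable τ)
    (hd : Disjoint A.dom B.dom) {a b : ℤ × ℤ} (ha : a ∈ A.dom) (hb : b ∈ B.dom)
    (hab : τ ≤ (A.union B).bond a b) : (A.union B).Stable τ := by
  -- A cut that splits one of the two pieces already has enough weight inside that piece.
  have extend : ∀ D : Supertile Λ, D.Stable τ → D.dom ⊆ (A.union B).dom →
      (∀ p ∈ D.dom, A.union B p = D p) → ∀ S : Set (ℤ × ℤ), (S ∩ D.dom).Nonempty →
      (D.dom \ S).Nonempty → ∃ E : Finset ((ℤ × ℤ) × (ℤ × ℤ)),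
        (∀ e ∈ E, e.1 ∈ S ∧ e.2 ∈ (A.union B).dom \ S) ∧
          τ ≤ ∑ e ∈ E, (A.union B).bond e.1 e.2 := by
    intro D hD hsub heq S h1 h2
    obtain ⟨E, hE, hs⟩ := hD (S ∩ D.dom) Set.inter_subset_right h1 (by
      obtain ⟨x, hx, hxS⟩ := h2
      exact ⟨x, hx, fun h => hxS h.1⟩)
    refine ⟨E, fun e he => ⟨(hE e he).1.1, hsub (hE e he).2.1, fun h =>
      (hE e he).2.2 ⟨h, (hE e he).2.1⟩⟩, hs.trans (Finset.sum_le_sum fun e he => ?_)⟩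
    exact (bond_congr (heq _ (hE e he).1.2) (heq _ (hE e he).2.1) rfl).ge
  have hAsub : A.dom ⊆ (A.union B).dom := by rw [dom_union]; exact Set.subset_union_left
  have hBsub : B.dom ⊆ (A.union B).dom := by rw [dom_union]; exact Set.subset_union_right
  intro S hS hne hne'
  by_cases hA1 : (S ∩ A.dom).Nonempty ∧ (A.dom \ S).Nonempty
  · exact extend A hA hAsub (fun p => union_apply_left) S hA1.1 hA1.2
  by_cases hB1 : (S ∩ B.dom).Nonempty ∧ (B.dom \ S).Nonempty
  · exact extend B hB hBsub (fun p => union_apply_right hd) S hB1.1 hB1.2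
  have hAS : a ∈ S → A.dom ⊆ S := fun h x hx => by_contra fun hn => hA1 ⟨⟨a, h, ha⟩, x, hx, hn⟩
  have hBS : b ∈ S → B.dom ⊆ S := fun h x hx => by_contra fun hn => hB1 ⟨⟨b, h, hb⟩, x, hx, hn⟩
  have hAS' : a ∉ S → ∀ x ∈ A.dom, x ∉ S := fun h x hx hn => hA1 ⟨⟨x, hn, hx⟩, a, ha, h⟩
  have hBS' : b ∉ S → ∀ x ∈ B.dom, x ∉ S := fun h x hx hn => hB1 ⟨⟨x, hn, hx⟩, b, hb, h⟩
  -- Now neither piece is split, so a nontrivial cut separates the pieces and severs the bond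
  -- between `a` and `b`.
  by_cases h1 : a ∈ S <;> by_cases h2 : b ∈ S
  · obtain ⟨x, hx, hxS⟩ := hne'
    rw [dom_union] at hx
    exact absurd (hx.elim (fun h => hAS h1 h) fun h => hBS h2 h) hxS
  · exact ⟨{(a, b)}, by simpa using ⟨h1, hBsub hb, h2⟩, by simpa using hab⟩
  · exact ⟨{(b, a)}, by simpa using ⟨h2, hAsub ha, h1⟩, by
      rw [Finset.sum_singleton, bond_comm]; exact hab⟩
  · obtain ⟨x, hx⟩ := hne
    have hx' := hS hx
    rw [dom_union] at hx'
    exact absurd hx (hx'.elim (hAS' h1 x) (hBS' h2 x))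

/-- A stable supertile binds with strength at least `τ` along the only edge that leaves a set. -/
theorem Stable.le_bond {τ : ℕ} {A : Supertile Λ} (hA : A.Stable τ) {P : Set (ℤ × ℤ)}
    {p q : ℤ × ℤ} (hp : p ∈ A.dom) (hpP : p ∈ P) (hq : q ∈ A.dom) (hqP : q ∉ P)
    (h : ∀ x ∈ A.dom, x ∈ P → ∀ y ∈ A.dom, y ∉ P → ∀ d : Side, y = x + d.vec → x = p ∧ y = q) :
    τ ≤ A.bond p q := by
  obtain ⟨E, hE, hs⟩ := hA (A.dom ∩ P) Set.inter_subset_left ⟨p, hp, hpP⟩ ⟨q, hq, fun hn => hqP hn.2⟩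
  refine hs.trans ?_
  have hz : ∀ e ∈ E, e ≠ (p, q) → A.bond e.1 e.2 = 0 := by
    intro e he hne
    by_contra hb
    obtain ⟨-, -, d, hd⟩ := bond_ne_zero hb
    obtain ⟨h1, h2⟩ := h e.1 (hE e he).1.1 (hE e he).1.2 e.2 (hE e he).2.1
      (fun hn => (hE e he).2.2 ⟨(hE e he).2.1, hn⟩) d hd
    exact hne (Prod.ext h1 h2)
  by_cases hmem : (p, q) ∈ E
  · rw [Finset.sum_eq_single_of_mem (p, q) hmem hz]
  · rw [Finset.sum_eq_zero fun e he => hz e he fun h => hmem (h ▸ he)]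
    exact Nat.zero_le _

/-! ### Restrictions and translates -/

open Classical in
/-- The part of a supertile inside a set of locations. -/
noncomputable def restrict (P : Set (ℤ × ℤ)) (A : Supertile Λ) : Supertile Λ :=
  fun p => if p ∈ P then A p else none

theorem restrict_apply {P : Set (ℤ × ℤ)} {A : Supertile Λ} {p : ℤ × ℤ} (h : p ∈ P) :
    A.restrict P p = A p := if_pos h

theorem dom_restrict (P : Set (ℤ × ℤ)) (A : Supertile Λ) : (A.restrict P).dom = A.dom ∩ P := by
  ext p
  by_cases h : p ∈ P <;> simp [dom, restrict, h]

theorem restrict_union (P : Set (ℤ × ℤ)) (A B : Supertile Λ) :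
    (A.union B).restrict P = (A.restrict P).union (B.restrict P) := by
  funext p
  by_cases h : p ∈ P <;> simp [restrict, union, h]

/-- The part of a stable supertile inside a set that only one location `p` of it joins to the
outside is stable. -/
theorem Stable.restrict {τ : ℕ} {A : Supertile Λ} (hA : A.Stable τ) {P : Set (ℤ × ℤ)}
    {p : ℤ × ℤ} (h : ∀ x ∈ A.dom, x ∈ P → ∀ y ∈ A.dom, y ∉ P → ∀ d : Side, y = x + d.vec → x = p) :
    (A.restrict P).Stable τ := by
  intro S hS hne hne'
  rw [dom_restrict] at hS hne'
  obtain ⟨y, ⟨hyA, hyP⟩, hyS⟩ := hne'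
  -- Extend the cut of the part to a cut of `A` by putting everything outside `P` on the side of
  -- `p`. Edges leaving `P` start at `p`, so none of them is severed.
  obtain ⟨T, hT, hTS, hTp⟩ : ∃ T ⊆ A.dom, T ∩ P = S ∧ (p ∈ S → A.dom \ P ⊆ T) ∧
      (p ∉ S → T ⊆ P) := by
    by_cases hp : p ∈ S
    · refine ⟨S ∪ A.dom \ P, Set.union_subset (fun x hx => (hS hx).1) Set.sdiff_subset, ?_,
        fun _ => Set.subset_union_right, fun h => absurd hp h⟩
      ext x
      constructor
      · rintro ⟨hx | hx, hxP⟩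
        exacts [hx, absurd hxP hx.2]
      · exact fun hx => ⟨Or.inl hx, (hS hx).2⟩
    · exact ⟨S, fun x hx => (hS hx).1, Set.inter_eq_left.2 fun x hx => (hS hx).2,
        fun h => absurd h hp, fun _ x hx => (hS hx).2⟩
  obtain ⟨E, hE, hs⟩ := hA T hT (hne.mono (hTS ▸ Set.inter_subset_left))
    ⟨y, hyA, fun hn => hyS (hTS ▸ ⟨hn, hyP⟩)⟩
  have key : ∀ e ∈ E, A.bond e.1 e.2 ≠ 0 → e.1 ∈ P ∧ e.2 ∈ P := by
    intro e he hb
    obtain ⟨h1, h2, d, hd⟩ := bond_ne_zero hb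
    obtain ⟨h3, -, h4⟩ := hE e he
    by_cases hp : p ∈ S
    · have hP2 : e.2 ∈ P := by_contra fun hn => h4 (hTp.1 hp ⟨h2, hn⟩)
      refine ⟨by_contra fun hn => h4 ?_, hP2⟩
      rw [h e.2 h2 hP2 e.1 h1 hn d.opp (by rw [Side.vec_opp, hd]; abel)]
      rw [← hTS] at hp
      exact hp.1
    · have hP1 := hTp.2 hp h3
      refine ⟨hP1, by_contra fun hn => hp ?_⟩
      rw [← h e.1 h1 hP1 e.2 h2 hn d hd, ← hTS]
      exact ⟨h3, hP1⟩
  classical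
  -- `E` may contain pairs of weight zero that do not lie in `P`; they are dropped.
  refine ⟨E.filter fun e => A.bond e.1 e.2 ≠ 0, fun e he => ?_, hs.trans ?_⟩
  · obtain ⟨he, hb⟩ := Finset.mem_filter.1 he
    obtain ⟨h1, h2⟩ := key e he hb
    rw [dom_restrict, ← hTS]
    exact ⟨⟨(hE e he).1, h1⟩, ⟨(hE e he).2.1, h2⟩, fun hn => (hE e he).2.2 hn.1⟩
  · rw [← Finset.sum_filter_ne_zero]
    refine Finset.sum_le_sum fun e he => ?_
    obtain ⟨he, hb⟩ := Finset.mem_filter.1 he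
    obtain ⟨h1, h2⟩ := key e he hb
    exact (bond_congr (restrict_apply h1).symm (restrict_apply h2).symm rfl).le

/-- The translate of a supertile by `v`. -/
def shift (v : ℤ × ℤ) (A : Supertile Λ) : Supertile Λ := fun p => A (p - v)

theorem mem_dom_shift {v p : ℤ × ℤ} {A : Supertile Λ} : p ∈ (A.shift v).dom ↔ p - v ∈ A.dom :=
  Iff.rfl

theorem shift_union (v : ℤ × ℤ) (A B : Supertile Λ) :
    (A.union B).shift v = (A.shift v).union (B.shift v) := rfl

theorem shift_single (v : ℤ × ℤ) (t : TileType Λ) (p : ℤ × ℤ) :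
    (single t p).shift v = single t (p + v) := by
  funext q
  simp only [shift, single, sub_eq_iff_eq_add]

theorem Stable.shift {τ : ℕ} {A : Supertile Λ} (hA : A.Stable τ) (v : ℤ × ℤ) :
    (A.shift v).Stable τ := by
  intro S hS ⟨x, hx⟩ ⟨y, hy, hyS⟩
  obtain ⟨E, hE, hs⟩ := hA ((fun p => p + v) ⁻¹' S) (fun p hp => by
      simpa [mem_dom_shift] using hS hp) ⟨x - v, by simpa using hx⟩
    ⟨y - v, hy, by simpa using hyS⟩
  refine ⟨E.map ⟨fun e => (e.1 + v, e.2 + v), fun e f h => by simpa [Prod.ext_iff] using h⟩, ?_, ?_⟩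
  · intro e he
    obtain ⟨f, hf, rfl⟩ := Finset.mem_map.1 he
    exact ⟨(hE f hf).1, by
      have : f.2 + v ∈ (A.shift v).dom \ S :=
        ⟨by simpa [mem_dom_shift] using (hE f hf).2.1, (hE f hf).2.2⟩
      exact this⟩
  · rw [Finset.sum_map]
    refine hs.trans (Finset.sum_le_sum fun e _ => (bond_congr ?_ ?_ ?_).le)
    · change A e.1 = A (e.1 + v - v)
      rw [add_sub_cancel_right]
    · change A e.2 = A (e.2 + v - v)
      rw [add_sub_cancel_right]
    · change e.2 - e.1 = e.2 + v - (e.1 + v)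
      rw [add_sub_add_right_eq_sub]

end Supertile

/-! ### Producible supertiles and their pieces -/

namespace TileSystem

open Supertile

variable {Λ : Type*} {𝒯 : TileSystem Λ}

theorem Producible.stable {A : Supertile Λ} (h : 𝒯.Producible A) : A.Stable 𝒯.temperature := by
  cases h with
  | tile t _ p => exact stable_single _ t p
  | combine A B C _ _ hC => exact hC.stable

theorem Producible.mem_tiles {A : Supertile Λ} (h : 𝒯.Producible A) {p : ℤ × ℤ} {t : TileType Λ}
    (hp : A p = some t) : t ∈ 𝒯.tiles := by
  induction h with
  | tile u hu q =>
    simp only [single] at hp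
    split_ifs at hp
    rwa [← Option.some.inj hp]
  | combine A B C _ _ hC ihA ihB =>
    rw [hC.eq_union, Supertile.union, Option.or_eq_some_iff] at hp
    exact hp.elim ihA fun h => ihB h.2

theorem Producible.shift {A : Supertile Λ} (h : 𝒯.Producible A) (v : ℤ × ℤ) :
    𝒯.Producible (A.shift v) := by
  induction h with
  | tile t ht p => exact shift_single v t p ▸ Producible.tile t ht _
  | combine A B C _ _ hC ihA ihB =>
    refine Producible.combine _ _ _ ihA ihB ⟨hC.stable_left.shift v, hC.stable_right.shift v, ?_,
      by rw [hC.eq_union, shift_union], hC.stable.shift v⟩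
    exact Set.disjoint_left.2 fun p hp hp' => Set.disjoint_left.1 hC.disjoint hp hp'

/-- The part of a producible supertile inside a set that only one location `p` of it joins to the
outside is producible. -/
theorem Producible.restrict {A : Supertile Λ} (hA : 𝒯.Producible A) {P : Set (ℤ × ℤ)}
    {p : ℤ × ℤ} (h : ∀ x ∈ A.dom, x ∈ P → ∀ y ∈ A.dom, y ∉ P → ∀ d : Side, y = x + d.vec → x = p)
    (hne : (A.dom ∩ P).Nonempty) : 𝒯.Producible (A.restrict P) := by
  induction hA with
  | tile t ht q =>
    have hq : q ∈ P := by
      rw [dom_single] at hne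
      obtain ⟨x, hx, hxP⟩ := hne
      rwa [← Set.mem_singleton_iff.1 hx]
    convert Producible.tile t ht q using 1
    funext x
    by_cases hx : x ∈ P
    · exact restrict_apply hx
    · have : x ≠ q := fun h => hx (h ▸ hq)
      simp [Supertile.restrict, single, hx, this]
  | combine A B C _ _ hC ihA ihB =>
    have hst := hC.stable.restrict h
    rw [hC.eq_union] at hst h hne ⊢
    rw [dom_union] at h hne
    -- The hypothesis on edges passes to both halves, so the assembly can be restricted to `P` step
    -- by step; a step where one half misses `P` becomes void.
    have hA' := fun x hx hxP y hy => h x (Or.inl hx) hxP y (Or.inl hy)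
    have hB' := fun x hx hxP y hy => h x (Or.inr hx) hxP y (Or.inr hy)
    have empty : ∀ D : Supertile Λ, ¬ (D.dom ∩ P).Nonempty → D.restrict P = fun _ => none := by
      intro D hD
      funext x
      by_contra hx
      have : x ∈ (D.restrict P).dom := hx
      rw [dom_restrict] at this
      exact hD ⟨x, this⟩
    rw [restrict_union] at hst ⊢
    by_cases hneA : (A.dom ∩ P).Nonempty
    · by_cases hneB : (B.dom ∩ P).Nonempty
      · refine Producible.combine _ _ _ (ihA hA' hneA) (ihB hB' hneB)
          ⟨(ihA hA' hneA).stable, (ihB hB' hneB).stable, ?_, rfl, hst⟩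
        rw [dom_restrict, dom_restrict]
        exact hC.disjoint.mono Set.inter_subset_left Set.inter_subset_left
      · convert ihA hA' hneA using 1
        funext x
        simp [Supertile.union, empty B hneB]
    · have hneB : (B.dom ∩ P).Nonempty := by
        rw [Set.union_inter_distrib_right] at hne
        exact (Set.union_nonempty.1 hne).resolve_left hneA
      convert ihB hB' hneB using 1
      funext x
      simp [Supertile.union, empty A hneA]

/-- Every finite part of an assembled shape occurs in a producible supertile inside the shape. -/
theorem FinitelySelfAssembles.exists_producible {X F : Set (ℤ × ℤ)}
    (h : 𝒯.FinitelySelfAssembles X) (hF : F.Finite) (hFX : F ⊆ X) :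
    ∃ A : Supertile Λ, 𝒯.Producible A ∧ F ⊆ A.dom ∧ A.dom ⊆ X := by
  obtain ⟨t, ht⟩ := 𝒯.tiles_nonempty
  obtain ⟨-, A, R, hA0, hseq, hres, v, hv⟩ := h _ (Producible.tile t ht 0)
  have hprod : ∀ i, 𝒯.Producible (A i) := by
    intro i
    induction i with
    | zero => exact hA0 ▸ Producible.tile t ht 0
    | succ i ih =>
      obtain ⟨B, hB, hC⟩ := hseq i
      exact Producible.combine _ _ _ ih hB hC
  have hmono : Monotone fun i => (A i).dom := monotone_nat_of_le_succ fun i => by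
    obtain ⟨B, hB, hC⟩ := hseq i
    rw [hC.eq_union, dom_union]
    exact Set.subset_union_left
  have hmem : ∀ p, p ∈ X ↔ ∃ i, p - v ∈ (A i).dom := by
    intro p
    have : p ∈ X ↔ p - v ∈ R.dom := by
      rw [← hv]
      constructor
      · rintro ⟨q, hq, rfl⟩
        simpa using hq
      · exact fun hq => ⟨p - v, hq, by simp⟩
    rw [this, mem_dom]
    constructor
    · rintro ⟨t, ht⟩
      obtain ⟨i, hi⟩ := (hres _ t).1 ht
      exact ⟨i, mem_dom.2 ⟨t, hi⟩⟩
    · rintro ⟨i, hi⟩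
      obtain ⟨t, ht⟩ := mem_dom.1 hi
      exact ⟨t, (hres _ t).2 ⟨i, ht⟩⟩
  -- The members of the sequence increase, so finitely many locations are all covered at some stage.
  have hsub : ∃ i, F ⊆ ((A i).shift v).dom := by
    induction F, hF using Set.Finite.induction_on with
    | empty => exact ⟨0, Set.empty_subset _⟩
    | @insert f F _ _ ih =>
      obtain ⟨i, hi⟩ := ih ((Set.subset_insert _ _).trans hFX)
      obtain ⟨j, hj⟩ := (hmem f).1 (hFX (Set.mem_insert _ _))
      refine ⟨max i j, Set.insert_subset (hmono (le_max_right i j) hj) fun p hp => ?_⟩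
      exact hmono (le_max_left i j) (hi hp)
  obtain ⟨i, hi⟩ := hsub
  exact ⟨_, (hprod i).shift v, hi, fun p hp => (hmem p).2 ⟨i, hp⟩⟩

end TileSystem

end TwoHAM

/-! ### The fractal in terms of digits in bases four and five -/

namespace Fractal

/-- The generator with 13 points. -/
def combGenerator : Finset (ℤ × ℤ) :=
  {(0, 4), (1, 4), (2, 4), (3, 4), (0, 3), (2, 3), (0, 2), (2, 2), (0, 1),
    (0, 0), (1, 0), (2, 0), (3, 0)}

theorem combGenerator_subset : combGenerator ⊆ Finset.Ico 0 4 ×ˢ Finset.Ico 0 5 := by decide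

theorem combGenerator_bounds {x y : ℤ} (h : (x, y) ∈ combGenerator) :
    0 ≤ x ∧ x < 4 ∧ 0 ≤ y ∧ y < 5 := by
  simpa [and_assoc] using combGenerator_subset h

theorem left_combGenerator : left combGenerator = 0 := by
  refine IsLeast.csInf_eq ⟨⟨(0, 0), by simp [combGenerator], rfl⟩, ?_⟩
  rintro _ ⟨p, hp, rfl⟩
  exact (combGenerator_bounds hp).1

theorem right_combGenerator : right combGenerator = 3 := by
  refine IsGreatest.csSup_eq ⟨⟨(3, 0), by simp [combGenerator], rfl⟩, ?_⟩
  rintro _ ⟨p, hp, rfl⟩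
  exact Int.le_of_lt_add_one (combGenerator_bounds hp).2.1

theorem bottom_combGenerator : bottom combGenerator = 0 := by
  refine IsLeast.csInf_eq ⟨⟨(0, 0), by simp [combGenerator], rfl⟩, ?_⟩
  rintro _ ⟨p, hp, rfl⟩
  exact (combGenerator_bounds hp).2.2.1

theorem top_combGenerator : top combGenerator = 4 := by
  refine IsGreatest.csSup_eq ⟨⟨(0, 4), by simp [combGenerator], rfl⟩, ?_⟩
  rintro _ ⟨p, hp, rfl⟩
  exact Int.le_of_lt_add_one (combGenerator_bounds hp).2.2.2

theorem width_combGenerator : width combGenerator = 4 := by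
  simp [width, left_combGenerator, right_combGenerator]

theorem height_combGenerator : height combGenerator = 5 := by
  simp [height, bottom_combGenerator, top_combGenerator]

theorem gridGraph_combGenerator_connected :
    (gridGraph (combGenerator : Set (ℤ × ℤ))).Connected := by
  rw [SimpleGraph.connected_iff_exists_forall_reachable]
  refine ⟨⟨(0, 0), by simp [combGenerator]⟩, ?_⟩
  have step : ∀ {p q : ℤ × ℤ} (hp : p ∈ combGenerator) (hq : q ∈ combGenerator),
      (gridGraph (combGenerator : Set (ℤ × ℤ))).Reachable ⟨(0, 0), by simp [combGenerator]⟩ ⟨p, hp⟩ →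
      |p.1 - q.1| + |p.2 - q.2| = 1 →
      (gridGraph (combGenerator : Set (ℤ × ℤ))).Reachable ⟨(0, 0), by simp [combGenerator]⟩
        ⟨q, hq⟩ :=
    fun hp hq h hpq => h.trans (SimpleGraph.Adj.reachable hpq)
  have h00 := SimpleGraph.Reachable.refl (G := gridGraph (combGenerator : Set (ℤ × ℤ)))
    ⟨(0, 0), by simp [combGenerator]⟩
  have h01 := step (q := (0, 1)) _ (by decide) h00 (by decide)
  have h02 := step (q := (0, 2)) _ (by decide) h01 (by decide)
  have h03 := step (q := (0, 3)) _ (by decide) h02 (by decide)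
  have h04 := step (q := (0, 4)) _ (by decide) h03 (by decide)
  have h14 := step (q := (1, 4)) _ (by decide) h04 (by decide)
  have h24 := step (q := (2, 4)) _ (by decide) h14 (by decide)
  have h34 := step (q := (3, 4)) _ (by decide) h24 (by decide)
  have h23 := step (q := (2, 3)) _ (by decide) h24 (by decide)
  have h22 := step (q := (2, 2)) _ (by decide) h23 (by decide)
  have h10 := step (q := (1, 0)) _ (by decide) h00 (by decide)
  have h20 := step (q := (2, 0)) _ (by decide) h10 (by decide)
  have h30 := step (q := (3, 0)) _ (by decide) h20 (by decide)
  rintro ⟨p, hp⟩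
  have hp' : p ∈ combGenerator := hp
  simp only [combGenerator, Finset.mem_insert, Finset.mem_singleton] at hp'
  rcases hp' with rfl | rfl | rfl | rfl | rfl | rfl | rfl | rfl | rfl | rfl | rfl | rfl | rfl <;>
    assumption

theorem isGenerator_combGenerator : IsGenerator combGenerator where
  origin := by
    refine ⟨by simp [combGenerator], fun h => ?_⟩
    have := h (show (1, 0) ∈ combGenerator by decide)
    simp at this
  in_box := ⟨5, combGenerator_subset.trans (by decide)⟩
  row := by
    rw [bottom_combGenerator, top_combGenerator]
    intro y hy
    exact ⟨0, by fin_cases hy <;> decide⟩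
  column := by
    rw [left_combGenerator, right_combGenerator]
    intro x hx
    exact ⟨0, by fin_cases hx <;> decide⟩
  connected := gridGraph_combGenerator_connected
  one_lt_width := by rw [width_combGenerator]; norm_num
  one_lt_height := by rw [height_combGenerator]; norm_num
  proper := by
    rw [width_combGenerator, height_combGenerator]
    decide

/-- The left, top and bottom sides are full. -/
theorem three_le_card_sides : 3 ≤ (({leftSide combGenerator, rightSide combGenerator,
    topSide combGenerator, bottomSide combGenerator} :
      Finset (Finset (ℤ × ℤ))).filter (fun S => S ∩ combGenerator = S)).card := by
  rw [leftSide, rightSide, topSide, bottomSide, left_combGenerator, right_combGenerator,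
    bottom_combGenerator, top_combGenerator]
  decide

/-- The fractal generated by `combGenerator`. -/
def combFractal : Set (ℤ × ℤ) := ⋃ i, stage combGenerator i

theorem ediv_pow_emod_add {m a c : ℤ} (hm : 0 < m) {j n : ℕ} (hj : j < n) :
    (a + m ^ n * c) / m ^ j % m = a / m ^ j % m := by
  obtain ⟨i, rfl⟩ := Nat.exists_eq_add_of_lt hj
  have : a + m ^ (j + i + 1) * c = a + m ^ j * (m * (m ^ i * c)) := by ring
  rw [this, Int.add_mul_ediv_left _ _ (pow_pos hm j).ne', Int.add_mul_emod_self_left]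

/-- The scaled sum appends one leading digit to each coordinate, so membership is a condition on
each pair of digits. -/
theorem mem_stage {i : ℕ} {p : ℤ × ℤ} : p ∈ stage combGenerator i ↔
    (0 ≤ p.1 ∧ p.1 < 4 ^ (i + 1)) ∧ (0 ≤ p.2 ∧ p.2 < 5 ^ (i + 1)) ∧
      ∀ j ≤ i, (p.1 / 4 ^ j % 4, p.2 / 5 ^ j % 5) ∈ combGenerator := by
  induction i generalizing p with
  | zero =>
    constructor
    · intro h
      obtain ⟨h1, h2, h3, h4⟩ := combGenerator_bounds (x := p.1) (y := p.2) h
      refine ⟨⟨h1, by simpa⟩, ⟨h3, by simpa⟩, fun j hj => ?_⟩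
      obtain rfl : j = 0 := by omega
      rw [pow_zero, pow_zero, Int.ediv_one, Int.ediv_one, Int.emod_eq_of_lt h1 h2,
        Int.emod_eq_of_lt h3 h4]
      exact h
    · rintro ⟨⟨h1, h2⟩, ⟨h3, h4⟩, h⟩
      have := h 0 le_rfl
      rw [pow_zero, pow_zero, Int.ediv_one, Int.ediv_one, Int.emod_eq_of_lt h1 (by simpa using h2),
        Int.emod_eq_of_lt h3 (by simpa using h4)] at this
      exact this
  | succ i ih =>
    have h4 : (0 : ℤ) < 4 ^ (i + 1) := by positivity
    have h5 : (0 : ℤ) < 5 ^ (i + 1) := by positivity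
    rw [stage, width_combGenerator, height_combGenerator]
    constructor
    · rintro ⟨a, ha, ⟨b1, b2⟩, hb, rfl⟩
      obtain ⟨⟨ha1, ha2⟩, ⟨ha3, ha4⟩, had⟩ := ih.1 ha
      obtain ⟨hb1, hb2, hb3, hb4⟩ := combGenerator_bounds hb
      refine ⟨⟨by positivity, ?_⟩, ⟨by positivity, ?_⟩, fun j hj => ?_⟩
      · rw [pow_succ _ (i + 1)]; simp only; nlinarith
      · rw [pow_succ _ (i + 1)]; simp only; nlinarith
      · rcases Nat.lt_or_eq_of_le hj with hj | rfl
        · simp only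
          rw [ediv_pow_emod_add (by norm_num) hj, ediv_pow_emod_add (by norm_num) hj]
          exact had j (by omega)
        · simp only
          rw [Int.add_mul_ediv_left _ _ h4.ne', Int.add_mul_ediv_left _ _ h5.ne',
            Int.ediv_eq_zero_of_lt ha1 ha2, Int.ediv_eq_zero_of_lt ha3 ha4, zero_add, zero_add,
            Int.emod_eq_of_lt hb1 hb2, Int.emod_eq_of_lt hb3 hb4]
          exact hb
    · rintro ⟨⟨h1, h2⟩, ⟨h3, h4'⟩, h⟩
      refine ⟨(p.1 % 4 ^ (i + 1), p.2 % 5 ^ (i + 1)), ih.2 ⟨⟨Int.emod_nonneg _ h4.ne',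
        Int.emod_lt_of_pos _ h4⟩, ⟨Int.emod_nonneg _ h5.ne', Int.emod_lt_of_pos _ h5⟩,
        fun j hj => ?_⟩, (p.1 / 4 ^ (i + 1), p.2 / 5 ^ (i + 1)), ?_, ?_⟩
      · have := h j (by omega)
        rw [← Int.emod_add_mul_ediv p.1 (4 ^ (i + 1)), ← Int.emod_add_mul_ediv p.2 (5 ^ (i + 1)),
          ediv_pow_emod_add (by norm_num) (by omega), ediv_pow_emod_add (by norm_num) (by omega)]
          at this
        exact this
      · have := h (i + 1) le_rfl
        rw [Int.emod_eq_of_lt (Int.ediv_nonneg h1 h4.le)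
          (Int.ediv_lt_of_lt_mul h4 (by rwa [mul_comm, ← pow_succ])),
          Int.emod_eq_of_lt (Int.ediv_nonneg h3 h5.le)
          (Int.ediv_lt_of_lt_mul h5 (by rwa [mul_comm, ← pow_succ]))] at this
        exact this
      · simp only [Int.emod_add_mul_ediv]

theorem mem_combFractal {x y : ℤ} : (x, y) ∈ combFractal ↔
    0 ≤ x ∧ 0 ≤ y ∧ ∀ i : ℕ, (x / 4 ^ i % 4, y / 5 ^ i % 5) ∈ combGenerator := by
  rw [combFractal, Set.mem_iUnion]
  constructor
  · rintro ⟨i, hi⟩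
    obtain ⟨⟨h1, h2⟩, ⟨h3, h4⟩, h⟩ := mem_stage.1 hi
    refine ⟨h1, h3, fun j => ?_⟩
    by_cases hj : j ≤ i
    · exact h j hj
    · simp only at h1 h2 h3 h4
      -- Digits beyond the stage are zero, and the origin belongs to the generator.
      rw [Int.ediv_eq_zero_of_lt h1 (h2.trans_le (pow_le_pow_right₀ (by norm_num) (by omega))),
        Int.ediv_eq_zero_of_lt h3 (h4.trans_le (pow_le_pow_right₀ (by norm_num) (by omega)))]
      decide
  · rintro ⟨h1, h2, h⟩
    lift x to ℕ using h1
    lift y to ℕ using h2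
    -- Any stage large enough to contain the point works; n < 4^n and n < 5^n make this one suffice.
    refine ⟨max x y, mem_stage.2 ⟨⟨by positivity, ?_⟩, ⟨by positivity, ?_⟩, fun j _ => h j⟩⟩
    · have := Nat.lt_pow_self (n := max x y + 1) (a := 4) (by norm_num)
      simp only
      exact_mod_cast (by omega : x < 4 ^ (max x y + 1))
    · have := Nat.lt_pow_self (n := max x y + 1) (a := 5) (by norm_num)
      simp only
      exact_mod_cast (by omega : y < 5 ^ (max x y + 1))

theorem digits_mem {x y : ℤ} (h : (x, y) ∈ combFractal) (k : ℕ) :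
    (x / 4 ^ k % 4, y / 5 ^ k % 5) ∈ combGenerator := (mem_combFractal.1 h).2.2 k

theorem mem_combFractal_iff_ediv {x y : ℤ} : (x, y) ∈ combFractal ↔
    (x % 4, y % 5) ∈ combGenerator ∧ (x / 4, y / 5) ∈ combFractal := by
  simp only [mem_combFractal]
  constructor
  · rintro ⟨h1, h2, h⟩
    refine ⟨by simpa using h 0, by positivity, by positivity, fun i => ?_⟩
    rw [Int.ediv_ediv_of_nonneg (by norm_num), Int.ediv_ediv_of_nonneg (by norm_num), ← pow_succ',
      ← pow_succ']
    exact h (i + 1)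
  · rintro ⟨h0, h1, h2, h⟩
    refine ⟨by omega, by omega, fun i => ?_⟩
    cases i with
    | zero => simpa using h0
    | succ i =>
      rw [pow_succ', pow_succ', ← Int.ediv_ediv_of_nonneg (by norm_num),
        ← Int.ediv_ediv_of_nonneg (by norm_num)]
      exact h i

theorem zero_mem_combFractal : ((0 : ℤ), (0 : ℤ)) ∈ combFractal :=
  mem_combFractal.2 ⟨le_rfl, le_rfl, fun i => by simp; decide⟩

theorem mem_combFractal_of_mem_combGenerator {x y : ℤ} (h : (x, y) ∈ combGenerator) :
    (x, y) ∈ combFractal := by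
  obtain ⟨h1, h2, h3, h4⟩ := combGenerator_bounds h
  rw [mem_combFractal_iff_ediv, Int.emod_eq_of_lt h1 h2, Int.emod_eq_of_lt h3 h4,
    Int.ediv_eq_zero_of_lt h1 h2, Int.ediv_eq_zero_of_lt h3 h4]
  exact ⟨h, zero_mem_combFractal⟩

/-- The leftmost column of a block of level `k` is full. -/
theorem mem_combFractal_of_column {c y : ℤ} (k : ℕ) (h : (c, y / 5 ^ k) ∈ combFractal) :
    (c * 4 ^ k, y) ∈ combFractal := by
  induction k generalizing y with
  | zero => simpa using h
  | succ k ih =>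
    rw [mem_combFractal_iff_ediv, pow_succ, ← mul_assoc, Int.mul_emod_left,
      Int.mul_ediv_cancel _ (by norm_num)]
    constructor
    · have h1 := Int.emod_nonneg y (b := 5) (by norm_num)
      have h2 := Int.emod_lt_of_pos y (b := 5) (by norm_num)
      interval_cases y % 5 <;> decide
    · apply ih
      rwa [Int.ediv_ediv_of_nonneg (by norm_num), ← pow_succ']

/-- The number with `k` digits in base five, all equal to one. -/
def repunit : ℕ → ℤ
  | 0 => 0
  | k + 1 => 5 * repunit k + 1

theorem four_mul_repunit (k : ℕ) : 4 * repunit k + 1 = 5 ^ k := by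
  induction k with
  | zero => rfl
  | succ k ih => rw [repunit, pow_succ, ← ih]; ring

theorem repunit_nonneg (k : ℕ) : 0 ≤ repunit k := by
  have := four_mul_repunit k
  have : (0 : ℤ) < 5 ^ k := by positivity
  omega

theorem repunit_mono : Monotone repunit := monotone_nat_of_le_succ fun k => by
  have := repunit_nonneg k
  rw [repunit]
  omega

theorem repunit_lt (k : ℕ) : repunit k < 5 ^ k := by
  have := four_mul_repunit k
  have := repunit_nonneg k
  omega

/-- Blocks of level `k` have a single location in the row whose digits are all equal to one. -/
theorem pow_dvd_of_mem {k : ℕ} {x m : ℤ} (h : (x, m * 5 ^ k + repunit k) ∈ combFractal) :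
    4 ^ k ∣ x := by
  induction k generalizing x with
  | zero => simp
  | succ k ih =>
    have e : m * 5 ^ (k + 1) + repunit (k + 1) = 1 + 5 * (m * 5 ^ k + repunit k) := by
      rw [repunit]; ring
    rw [mem_combFractal_iff_ediv, e] at h
    obtain ⟨h1, h2⟩ := h
    have e1 : (1 + 5 * (m * 5 ^ k + repunit k)) % 5 = 1 := by omega
    have e2 : (1 + 5 * (m * 5 ^ k + repunit k)) / 5 = m * 5 ^ k + repunit k := by omega
    rw [e1] at h1
    rw [e2] at h2
    obtain ⟨c, hc⟩ := ih h2
    -- Row 1 of the generator consists of the origin column only.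
    have h3 : x % 4 = 0 := by
      simpa [combGenerator] using h1
    exact ⟨c, by rw [pow_succ]; linarith [Int.emod_add_mul_ediv x 4]⟩

theorem not_isTreeFractal_combFractal : ¬ IsTreeFractal combFractal := by
  rintro ⟨-, -, hac⟩
  have m1 : ((0 : ℤ), (4 : ℤ)) ∈ combFractal := mem_combFractal_of_mem_combGenerator (by decide)
  have m2 : ((1 : ℤ), (4 : ℤ)) ∈ combFractal := mem_combFractal_of_mem_combGenerator (by decide)
  have m3 : ((0 : ℤ), (5 : ℤ)) ∈ combFractal := mem_combFractal_iff_ediv.2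
    ⟨by decide, mem_combFractal_of_mem_combGenerator (by decide)⟩
  have m4 : ((1 : ℤ), (5 : ℤ)) ∈ combFractal := mem_combFractal_iff_ediv.2
    ⟨by decide, mem_combFractal_of_mem_combGenerator (by decide)⟩
  have a12 : (gridGraph combFractal).Adj ⟨_, m1⟩ ⟨_, m2⟩ := by simp [gridGraph]
  have a24 : (gridGraph combFractal).Adj ⟨_, m2⟩ ⟨_, m4⟩ := by simp [gridGraph]
  have a13 : (gridGraph combFractal).Adj ⟨_, m1⟩ ⟨_, m3⟩ := by simp [gridGraph]
  have a34 : (gridGraph combFractal).Adj ⟨_, m3⟩ ⟨_, m4⟩ := by simp [gridGraph]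
  -- The full top row of one block touches the full bottom row of the next, which gives a 4-cycle,
  -- hence two paths between opposite corners.
  have := (SimpleGraph.isAcyclic_iff_subsingleton_path.1 hac _ _).elim
    (⟨.cons a12 (.cons a24 .nil), by simp⟩ : (gridGraph combFractal).Path _ _) ⟨.cons a13 (.cons a34 .nil), by simp⟩
  have hs := congrArg (fun w : (gridGraph combFractal).Path _ _ => w.1.support) this
  simp at hs

end Fractal

/-! ### Cutting teeth and the two-column obstruction -/

namespace Fractal

open TwoHAM

/-- The columns `c` of blocks of level `k`, from the row `r` of blocks up to the row of locations in
the row `s` of blocks whose digits are all equal to one. -/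
def hangingPart (k : ℕ) (c r s : ℤ) : Set (ℤ × ℤ) :=
  {p | p.1 / 4 ^ k = c ∧ r * 5 ^ k ≤ p.2 ∧ p.2 ≤ s * 5 ^ k + repunit k}

/-- A single edge of the fractal leaves a hanging part. -/
theorem hangingPart_edge {k : ℕ} {c r s : ℤ} (hc : c % 4 = 2) (hr : r % 5 = 2)
    (hrs : r ≤ s) (hsr : s ≤ r + 1) {p q : ℤ × ℤ} (hp : p ∈ combFractal) (hq : q ∈ combFractal)
    (hpH : p ∈ hangingPart k c r s) (hqH : q ∉ hangingPart k c r s) {d : Side}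
    (hd : q = p + d.vec) : p = (c * 4 ^ k, s * 5 ^ k + repunit k) ∧
      q = (c * 4 ^ k, s * 5 ^ k + repunit k + 1) := by
  obtain ⟨u, v⟩ := p
  obtain ⟨h1, h2, h3⟩ := hpH
  simp only at h1 h2 h3
  have ha : (0 : ℤ) < 4 ^ k := by positivity
  have hb : (0 : ℤ) < 5 ^ k := by positivity
  have hY := repunit_lt k
  have hY0 := repunit_nonneg k
  have hv1 : r ≤ v / 5 ^ k := Int.le_ediv_of_mul_le hb h2
  have hv2 : v / 5 ^ k < s + 1 := Int.ediv_lt_of_lt_mul hb (by linarith)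
  have hv : v / 5 ^ k % 5 = 2 ∨ v / 5 ^ k % 5 = 3 := by omega
  -- A sideways step would enter a block with column digit 1 or 3 and row digit 2 or 3, which the
  -- generator lacks.
  have horiz : ∀ e : ℤ, e = 1 ∨ e = -1 → (u + e, v) ∈ combFractal →
      (u + e, v) ∉ hangingPart k c r s → False := by
    intro e he hm hn
    have hne : (u + e) / 4 ^ k ≠ c := fun h => hn ⟨h, h2, h3⟩
    have hle : (u + e) / 4 ^ k ≤ c + 1 := by
      have : (u + e) / 4 ^ k ≤ (u + 4 ^ k * 1) / 4 ^ k :=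
        Int.ediv_le_ediv ha (by rcases he with rfl | rfl <;> linarith)
      rwa [Int.add_mul_ediv_left _ _ ha.ne', h1] at this
    have hge : c - 1 ≤ (u + e) / 4 ^ k := by
      have : (u + 4 ^ k * (-1)) / 4 ^ k ≤ (u + e) / 4 ^ k :=
        Int.ediv_le_ediv ha (by rcases he with rfl | rfl <;> linarith)
      rwa [Int.add_mul_ediv_left _ _ ha.ne', h1] at this
    have hdig := digits_mem hm k
    have : (u + e) / 4 ^ k % 4 = 1 ∨ (u + e) / 4 ^ k % 4 = 3 := by omega
    rcases this with h | h <;> rcases hv with h' | h' <;> rw [h, h'] at hdig <;>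
      revert hdig <;> decide
  cases d with
  | north =>
    obtain rfl : q = (u, v + 1) := by simpa [Side.vec] using hd
    -- An upward exit is possible only in the top row, whose digits of index below `k` are all 1;
    -- there `pow_dvd_of_mem` fixes the column.
    have hv' : v = s * 5 ^ k + repunit k := by
      by_contra hne
      exact hqH ⟨h1, by simp only; linarith, by simp only; omega⟩
    subst hv'
    obtain ⟨m, rfl⟩ := pow_dvd_of_mem hp
    rw [Int.mul_ediv_cancel_left _ ha.ne'] at h1
    subst h1
    simp [mul_comm]
  | south =>
    obtain rfl : q = (u, v - 1) := by simpa [Side.vec, sub_eq_add_neg] using hd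
    have hv' : v = r * 5 ^ k := by
      by_contra hne
      exact hqH ⟨h1, by simp only; omega, by simp only; linarith⟩
    -- A downward exit would enter a block with digits (2,1), which the generator lacks.
    have hdig := digits_mem hq k
    have : (v - 1) / 5 ^ k = r - 1 := by
      rw [Int.ediv_eq_iff_of_pos hb]
      constructor <;> linarith
    rw [h1, this, hc, show (r - 1) % 5 = 1 by omega] at hdig
    exact absurd hdig (by decide)
  | east =>
    obtain rfl : q = (u + 1, v) := by simpa [Side.vec] using hd
    exact (horiz 1 (Or.inl rfl) hq hqH).elim
  | west =>
    obtain rfl : q = (u + -1, v) := by simpa [Side.vec] using hd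
    exact (horiz (-1) (Or.inr rfl) hq hqH).elim

theorem exists_row_digit_eq_one (k : ℕ) (s : ℤ) :
    ∃ y, s ≤ y ∧ y ≤ s + 4 * 5 ^ k ∧ y / 5 ^ k % 5 = 1 := by
  have hb : (0 : ℤ) < 5 ^ k := by positivity
  have h1 := Int.emod_nonneg (1 - s / 5 ^ k) (b := 5) (by norm_num)
  have h2 := Int.emod_lt_of_pos (1 - s / 5 ^ k) (b := 5) (by norm_num)
  -- Adding j * 5^k raises the digit of index `k` by j modulo 5, so some j ≤ 4 turns it into 1.
  refine ⟨s + 5 ^ k * ((1 - s / 5 ^ k) % 5), by nlinarith, by nlinarith, ?_⟩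
  rw [Int.add_mul_ediv_left _ _ hb.ne']
  omega

/-- Two columns at distance `2 * 4 ^ k` cannot both have `5 ^ (k + 1)` consecutive locations in the
fractal. -/
theorem not_two_columns {k : ℕ} {x y z : ℤ}
    (h1 : ∀ v, y ≤ v → v ≤ y + 4 * 5 ^ k → (x, v) ∈ combFractal)
    (h2 : ∀ v, z ≤ v → v ≤ z + 4 * 5 ^ k → (x + 2 * 4 ^ k, v) ∈ combFractal) : False := by
  have hrow : ∀ t : ℤ, (t, 1) ∈ combGenerator → t = 0 := by
    intro t ht
    simpa [combGenerator] using ht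
  obtain ⟨v, hv1, hv2, hv⟩ := exists_row_digit_eq_one k y
  obtain ⟨w, hw1, hw2, hw⟩ := exists_row_digit_eq_one k z
  have e1 := hrow _ (hv ▸ digits_mem (h1 v hv1 hv2) k)
  have e2 := hrow _ (hw ▸ digits_mem (h2 w hw1 hw2) k)
  rw [Int.add_mul_ediv_right _ _ (by positivity)] at e2
  omega

end Fractal

/-! ### The forbidden producible supertile -/

namespace Fractal

open TwoHAM

variable {Λ : Type*} {𝒯 : TileSystem Λ}

theorem restrict_hangingPart {A : Supertile Λ} (hA : 𝒯.Producible A) (hX : A.dom ⊆ combFractal)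
    {k : ℕ} {c r s : ℤ} (hc : c % 4 = 2) (hr : r % 5 = 2) (hrs : r ≤ s) (hsr : s ≤ r + 1)
    {p : ℤ × ℤ} (hp : p ∈ A.dom) (hpH : p ∈ hangingPart k c r s) :
    𝒯.Producible (A.restrict (hangingPart k c r s)) :=
  hA.restrict (fun _ hx hxH _ hy hyH _ hd =>
    (hangingPart_edge hc hr hrs hsr (hX hx) (hX hy) hxH hyH hd).1) ⟨p, hp, hpH⟩

/-- The severed edge has a single end on the outside too, so the complement can also be cut off. -/
theorem restrict_compl_hangingPart {A : Supertile Λ} (hA : 𝒯.Producible A)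
    (hX : A.dom ⊆ combFractal) {k : ℕ} {c r s : ℤ} (hc : c % 4 = 2) (hr : r % 5 = 2) (hrs : r ≤ s)
    (hsr : s ≤ r + 1) {p : ℤ × ℤ} (hp : p ∈ A.dom) (hpH : p ∉ hangingPart k c r s) :
    𝒯.Producible (A.restrict (hangingPart k c r s)ᶜ) :=
  hA.restrict (fun x hx hxH y hy hyH d hd =>
    (hangingPart_edge (d := d.opp) hc hr hrs hsr (hX hy) (hX hx) (not_not.1 hyH) hxH
      (by rw [Side.vec_opp, hd]; abel)).2) ⟨p, hp, hpH⟩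

/-- The part of the fractal between two hanging parts of level `k + 1` and outside one of
level `k`. -/
def middlePart (k : ℕ) : Set (ℤ × ℤ) :=
  hangingPart (k + 1) 2 2 3 ∩ (hangingPart (k + 1) 2 2 2)ᶜ ∩ (hangingPart k 10 12 12)ᶜ

/-- In the right half of the segment, the block rows 11 and 12 of level `k` allow only block
(10,12), as the digits (2,1), (3,1) and (3,2) are missing; the part of that block up to the cut has
been removed. -/
theorem lt_of_mem_middlePart {k : ℕ} {x y : ℤ} (hX : (x, y) ∈ combFractal)
    (h : (x, y) ∈ middlePart k) (hx : 10 * 4 ^ k ≤ x) : 12 * 5 ^ k + repunit k < y := by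
  obtain ⟨⟨⟨h1, h2, h3⟩, h4⟩, h5⟩ := h
  simp only at h1 h2 h3
  have ha : (0 : ℤ) < 4 ^ k := by positivity
  have hb : (0 : ℤ) < 5 ^ k := by positivity
  have hY := repunit_lt k
  have hY0 := repunit_nonneg k
  have hY1 : repunit (k + 1) = repunit k + 5 ^ k := by
    rw [repunit, ← four_mul_repunit]; ring
  have h4' : 2 * 5 ^ (k + 1) + repunit (k + 1) < y := by
    by_contra hn
    exact h4 ⟨h1, h2, not_lt.1 hn⟩
  rw [hY1, pow_succ] at h4'
  by_contra hn
  rw [not_lt] at hn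
  rw [pow_succ, ← Int.ediv_ediv_of_nonneg ha.le] at h1
  have hx1 : 10 ≤ x / 4 ^ k := Int.le_ediv_of_mul_le ha hx
  have hy1 : 11 ≤ y / 5 ^ k := Int.le_ediv_of_mul_le hb (by linarith)
  have hy2 : y / 5 ^ k < 13 := Int.ediv_lt_of_lt_mul hb (by linarith)
  have hdig := digits_mem hX k
  have hx2 : x / 4 ^ k = 10 ∨ x / 4 ^ k = 11 := by omega
  have hy3 : y / 5 ^ k = 11 ∨ y / 5 ^ k = 12 := by omega
  rcases hx2 with e | e <;> rcases hy3 with e' | e' <;> rw [e, e'] at hdig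
  · exact absurd hdig (by decide)
  · refine h5 ⟨e, ?_, hn⟩
    have := Int.mul_ediv_self_le (x := y) hb.ne'
    rw [e'] at this
    simp only
    linarith
  · exact absurd hdig (by decide)
  · exact absurd hdig (by decide)

theorem not_finitelySelfAssembles_combFractal : ¬ 𝒯.FinitelySelfAssembles combFractal := by
  intro h
  have ha : ∀ k : ℕ, (0 : ℤ) < 4 ^ k := fun k => by positivity
  have hb : ∀ k : ℕ, (0 : ℤ) < 5 ^ k := fun k => by positivity
  have hY := repunit_lt
  have hY0 := repunit_nonneg
  have hY1 : ∀ k, repunit (k + 1) = repunit k + 5 ^ k := fun k => by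
    rw [repunit, ← four_mul_repunit]; ring
  -- Left column of the small tooth.
  have col : ∀ (k : ℕ) (y : ℤ), 12 * 5 ^ k ≤ y → y < 14 * 5 ^ k →
      (10 * 4 ^ k, y) ∈ combFractal := by
    intro k y h1 h2
    have h3 : 12 ≤ y / 5 ^ k := Int.le_ediv_of_mul_le (hb k) h1
    have h4 : y / 5 ^ k < 14 := Int.ediv_lt_of_lt_mul (hb k) h2
    apply mem_combFractal_of_column
    rw [mem_combFractal_iff_ediv]
    obtain e | e : y / 5 ^ k = 12 ∨ y / 5 ^ k = 13 := by omega
    all_goals rw [e]; exact ⟨by decide, mem_combFractal_of_mem_combGenerator (by decide)⟩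
  -- Left column of the surrounding tooth, the spine.
  have col' : ∀ (k : ℕ) (y : ℤ), 10 * 5 ^ k ≤ y → y < 20 * 5 ^ k →
      (2 * 4 ^ (k + 1), y) ∈ combFractal := by
    intro k y h1 h2
    have h3 : 2 ≤ y / 5 ^ (k + 1) := Int.le_ediv_of_mul_le (hb _) (by rw [pow_succ]; linarith)
    have h4 : y / 5 ^ (k + 1) < 4 := Int.ediv_lt_of_lt_mul (hb _) (by rw [pow_succ]; linarith)
    apply mem_combFractal_of_column
    apply mem_combFractal_of_mem_combGenerator
    obtain e | e : y / 5 ^ (k + 1) = 2 ∨ y / 5 ^ (k + 1) = 3 := by omega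
    all_goals rw [e]; decide
  have hex := fun k : ℕ => h.exists_producible
    (F := combFractal ∩ Set.Icc (0, 0) (16 * 4 ^ k, 25 * 5 ^ k))
    ((Set.finite_Icc _ _).inter_of_right _) Set.inter_subset_left
  choose A hA hF hX using hex
  have hcol : ∀ (k : ℕ) (y : ℤ), 12 * 5 ^ k ≤ y → y < 14 * 5 ^ k →
      (10 * 4 ^ k, y) ∈ (A k).dom := fun k y h1 h2 =>
    hF k ⟨col k y h1 h2, ⟨by have := ha k; positivity, by have := hb k; simp only; linarith⟩,
      by have := ha k; simp only; linarith, by have := hb k; simp only; linarith⟩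
  have hcol' : ∀ (k : ℕ) (y : ℤ), 10 * 5 ^ k ≤ y → y < 20 * 5 ^ k →
      (2 * 4 ^ (k + 1), y) ∈ (A k).dom := fun k y h1 h2 =>
    hF k ⟨col' k y h1 h2, ⟨by have := ha k; positivity, by have := hb k; simp only; linarith⟩,
      by have := ha k; simp only [pow_succ]; linarith, by have := hb k; simp only; linarith⟩
  have hp : ∀ k, (10 * 4 ^ k, 12 * 5 ^ k + repunit k) ∈ (A k).dom := fun k =>
    hcol k _ (by linarith [hY0 k]) (by linarith [hY k, hb k])
  have hq : ∀ k, (10 * 4 ^ k, 12 * 5 ^ k + repunit k + 1) ∈ (A k).dom := fun k =>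
    hcol k _ (by linarith [hY0 k]) (by have := hY k; have := hb k; omega)
  have hpH : ∀ k, (10 * 4 ^ k, 12 * 5 ^ k + repunit k) ∈ hangingPart k 10 12 12 := fun k =>
    ⟨Int.mul_ediv_cancel _ (ha k).ne', by simp only; linarith [hY0 k], le_rfl⟩
  have hqH : ∀ k, (10 * 4 ^ k, 12 * 5 ^ k + repunit k + 1) ∉ hangingPart k 10 12 12 :=
    fun k hn => by
      have := hn.2.2
      simp only at this
      omega
  choose t ht using fun k => Supertile.mem_dom.1 (hq k)
  -- Pigeonhole on the even levels only, so that the two levels differ by at least 2.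
  obtain ⟨k, l, hkl, htl⟩ : ∃ k l, k + 2 ≤ l ∧ t k = t l := by
    obtain ⟨n, m, hnm, he⟩ := Finite.exists_ne_map_eq_of_infinite
      fun n : ℕ => (⟨t (2 * n), (hA _).mem_tiles (ht _)⟩ : 𝒯.tiles)
    have he' := Subtype.ext_iff.1 he
    rcases lt_or_gt_of_ne hnm with h | h
    · exact ⟨_, _, by omega, he'⟩
    · exact ⟨_, _, by omega, he'.symm⟩
  have hbond : 𝒯.temperature ≤ (A l).bond (10 * 4 ^ l, 12 * 5 ^ l + repunit l)
      (10 * 4 ^ l, 12 * 5 ^ l + repunit l + 1) :=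
    (hA l).stable.le_bond (hp l) (hpH l) (hq l) (hqH l) fun x hx hxH y hy hyH d hd =>
      hangingPart_edge (by norm_num) (by norm_num) (by norm_num) (by norm_num) (hX l hx) (hX l hy)
        hxH hyH hd
  have hqM : (10 * 4 ^ k, 12 * 5 ^ k + repunit k + 1) ∈ middlePart k := by
    refine ⟨⟨⟨?_, ?_, ?_⟩, fun hn => ?_⟩, hqH k⟩
    · rw [pow_succ, ← Int.ediv_ediv_of_nonneg (ha k).le, Int.mul_ediv_cancel _ (ha k).ne']
      norm_num
    · simp only [pow_succ]
      linarith [hY0 k, hb k]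
    · simp only [pow_succ, hY1]
      have := hY k; have := hb k; omega
    · have := hn.2.2
      simp only [pow_succ, hY1] at this
      linarith [hb k]
  have hM : 𝒯.Producible ((A k).restrict (middlePart k)) := by
    have e : (A k).restrict (middlePart k) = (((A k).restrict (hangingPart (k + 1) 2 2 3)).restrict
        (hangingPart (k + 1) 2 2 2)ᶜ).restrict (hangingPart k 10 12 12)ᶜ := by
      funext x
      by_cases h1 : x ∈ hangingPart (k + 1) 2 2 3 <;> by_cases h2 : x ∈ hangingPart (k + 1) 2 2 2 <;>
        by_cases h3 : x ∈ hangingPart k 10 12 12 <;> simp [Supertile.restrict, middlePart, h1, h2, h3]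
    have s1 : ((A k).restrict (hangingPart (k + 1) 2 2 3)).dom ⊆ combFractal := by
      rw [Supertile.dom_restrict]
      exact Set.inter_subset_left.trans (hX k)
    have m1 : (10 * 4 ^ k, 12 * 5 ^ k + repunit k + 1) ∈
        ((A k).restrict (hangingPart (k + 1) 2 2 3)).dom := by
      rw [Supertile.dom_restrict]
      exact ⟨hq k, hqM.1.1⟩
    rw [e]
    refine restrict_compl_hangingPart (p := (10 * 4 ^ k, 12 * 5 ^ k + repunit k + 1))
      (restrict_compl_hangingPart (restrict_hangingPart (hA k) (hX k) ?_ ?_ ?_ ?_ (hq k) hqM.1.1) s1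
        ?_ ?_ ?_ ?_ m1 hqM.1.2) ?_ ?_ ?_ ?_ ?_ ?_ hqM.2
    any_goals norm_num
    · rw [Supertile.dom_restrict]
      exact Set.inter_subset_left.trans s1
    · rw [Supertile.dom_restrict]
      exact ⟨m1, hqM.1.2⟩
  have hL : 𝒯.Producible ((A l).restrict (hangingPart l 10 12 12)) :=
    restrict_hangingPart (hA l) (hX l) (by norm_num) (by norm_num) (by norm_num) (by norm_num)
      (hp l) (hpH l)
  -- This translation moves the top of the large tooth's lower end to the place just below the
  -- stump.
  obtain ⟨w, hw⟩ : ∃ w : ℤ × ℤ, w = (10 * 4 ^ k - 10 * 4 ^ l,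
    12 * 5 ^ k + repunit k - (12 * 5 ^ l + repunit l)) := ⟨_, rfl⟩
  have hLw := hL.shift w
  have memM : ∀ p, p ∈ ((A k).restrict (middlePart k)).dom ↔ p ∈ (A k).dom ∧ p ∈ middlePart k := by
    intro p
    rw [Supertile.dom_restrict, Set.mem_inter_iff]
  have memL : ∀ p, p ∈ (((A l).restrict (hangingPart l 10 12 12)).shift w).dom ↔
      p - w ∈ (A l).dom ∧ p - w ∈ hangingPart l 10 12 12 := by
    intro p
    rw [Supertile.mem_dom_shift, Supertile.dom_restrict, Set.mem_inter_iff]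
  have hdisj : Disjoint ((A k).restrict (middlePart k)).dom
      (((A l).restrict (hangingPart l 10 12 12)).shift w).dom := by
    rw [Set.disjoint_left]
    -- The translated piece lies at or to the right of the stump's left column and no higher than
    -- the cut; the segment has no location there.
    rintro ⟨x, y⟩ hpM hpL
    rw [memM] at hpM
    obtain ⟨-, h1, -, h3⟩ := (memL _).1 hpL
    simp only [hw, Prod.mk_sub_mk] at h1 h3
    have hx : 10 * 4 ^ l ≤ x - (10 * 4 ^ k - 10 * 4 ^ l) := by
      have := Int.ediv_mul_le (x - (10 * 4 ^ k - 10 * 4 ^ l)) (ha l).ne'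
      rwa [h1] at this
    have := lt_of_mem_middlePart (hX k hpM.1) hpM.2 (by linarith)
    linarith
  have ep : ((10 : ℤ) * 4 ^ k, 12 * 5 ^ k + repunit k) - w =
      (10 * 4 ^ l, 12 * 5 ^ l + repunit l) := by
    rw [hw, Prod.mk_sub_mk, sub_sub_cancel, sub_sub_cancel]
  have hpL : (10 * 4 ^ k, 12 * 5 ^ k + repunit k) ∈
      (((A l).restrict (hangingPart l 10 12 12)).shift w).dom := by
    rw [memL, ep]
    exact ⟨hp l, hpH l⟩
  have hqM' := (memM _).2 ⟨hq k, hqM⟩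
  have hbond' : 𝒯.temperature ≤ (((A k).restrict (middlePart k)).union
      (((A l).restrict (hangingPart l 10 12 12)).shift w)).bond
      (10 * 4 ^ k, 12 * 5 ^ k + repunit k + 1) (10 * 4 ^ k, 12 * 5 ^ k + repunit k) := by
    rw [Supertile.bond_comm]
    refine hbond.trans (Supertile.bond_congr ?_ ?_ ?_).ge
    · rw [Supertile.union_apply_right hdisj hpL, Supertile.shift, ep,
        Supertile.restrict_apply (hpH l)]
    -- Here the equality of the two tiles above the cuts enters.
    · rw [Supertile.union_apply_left hqM', Supertile.restrict_apply hqM, ht, ht, htl]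
    · simp
  have hC := TileSystem.Producible.combine _ _ _ hM hLw
    ⟨hM.stable, hLw.stable, hdisj, rfl, hM.stable.union hLw.stable hdisj hqM' hpL hbond'⟩
  obtain ⟨⟨Y, hYX, v, hv⟩, -⟩ := h _ hC
  have hmem : ∀ p, p ∈ ((A k).restrict (middlePart k)).dom ∨
      p ∈ (((A l).restrict (hangingPart l 10 12 12)).shift w).dom → p + v ∈ combFractal := by
    intro p hpC
    apply hYX
    rw [← hv]
    refine ⟨p, ?_, rfl⟩
    rw [Supertile.dom_union]
    exact hpC
  have hkY := hY k
  have hkY0 := hY0 k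
  have hbk := hb k
  -- The first window starts at the bottom of the spine segment; the second lies in the attached
  -- piece, below the stump.
  refine not_two_columns (k := k) (x := 2 * 4 ^ (k + 1) + v.1) (y := 11 * 5 ^ k + repunit k + 1 + v.2)
    (z := 6 * 5 ^ k + repunit k + v.2) (fun y h1 h2 => ?_) fun y h1 h2 => ?_
  · have := hmem (2 * 4 ^ (k + 1), y - v.2) (Or.inl ((memM _).2 ⟨hcol' k _ ?_ ?_, ?_⟩))
    · simpa [Prod.add_def] using this
    · linarith
    · omega
    · refine ⟨⟨⟨Int.mul_ediv_cancel _ (ha _).ne', ?_, ?_⟩, fun hn => ?_⟩, fun hn => ?_⟩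
      · simp only [pow_succ]; linarith
      · simp only [pow_succ, hY1]; omega
      · have := hn.2.2
        simp only [pow_succ, hY1] at this
        omega
      · have := hn.1
        simp only at this
        rw [pow_succ, mul_comm (4 ^ k : ℤ), ← mul_assoc, Int.mul_ediv_cancel _ (ha k).ne'] at this
        norm_num at this
  -- A gap of two levels adds 5^k + 5^(k+1), enough for the attached column to reach down past the
  -- window; a gap of one would add only 5^k.
  · have hl : repunit k + 6 * 5 ^ k ≤ repunit l := by
      refine le_trans (le_of_eq ?_) (repunit_mono hkl)
      rw [hY1, hY1, pow_succ]
      ring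
    have hlY := hY l
    have hlb := hb l
    have e : ((10 : ℤ) * 4 ^ k, y - v.2) - w = (10 * 4 ^ l,
        y - v.2 - (12 * 5 ^ k + repunit k) + (12 * 5 ^ l + repunit l)) := by
      rw [hw, Prod.mk_sub_mk, sub_sub_cancel]
      congr 1
      ring
    have := hmem (10 * 4 ^ k, y - v.2) (Or.inr ((memL _).2 ?_))
    · convert this using 2
      · simp only [Prod.fst_add, pow_succ]; ring
      · simp
    · rw [e]
      refine ⟨hcol l _ (by linarith) (by linarith), Int.mul_ediv_cancel _ (ha l).ne', ?_, ?_⟩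
      · simp only; linarith
      · simp only; linarith

end Fractal

theorem theorem2 :
    ∃ X : Set (ℤ × ℤ),
      Fractal.HasGenerator
        {(0, 4), (1, 4), (2, 4), (3, 4), (0, 3), (2, 3), (0, 2), (2, 2), (0, 1),
          (0, 0), (1, 0), (2, 0), (3, 0)} X ∧
      Fractal.IsSided 3 X ∧
      ¬ Fractal.IsTreeFractal X ∧
      ∀ (Λ : Type*) (𝒯 : TwoHAM.TileSystem Λ), ¬ 𝒯.FinitelySelfAssembles X :=
  have hgen : Fractal.HasGenerator Fractal.combGenerator Fractal.combFractal :=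
    ⟨Fractal.isGenerator_combGenerator, rfl⟩
  ⟨Fractal.combFractal, hgen, ⟨_, hgen, Fractal.three_le_card_sides⟩,
    Fractal.not_isTreeFractal_combFractal,
    fun _ _ => Fractal.not_finitelySelfAssembles_combFractal⟩
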